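/- Let $R$ be an associative ring with identity, let $n$ be a positive integer, and let $G$ be a finite subgroup of $GL_n(R)$. Assume that $G$ has a free point, i.e. there is $i\in\{1,\dots,n\}$ with $g_{ii}=0$ for all $g=(g_{pq})\in G\setminus\{I_n\}$, and that $|G|$ is invertible in $R$. Let $S_n(G,R)=\{a\in M_n(R)\mid ag=ga \text{ for all } g\in G\}$. Modules are left modules. Then: (1) Writing $S=S_n(G,R)$ and $A=M_n(R)$, the ring extension $S\subseteq A$ is a split Frobenius extension; that is, ${}_SA$ is a finitely generated projective $S$-module, $\operatorname{Hom}_S({}_SA,S)\cong{}_AA_S$ as $A$-$S$-bimodules, and ${}_SS_S$ is a direct summand of the $S$-$S$-bimodule ${}_SA_S$. Moreover, $S_n(G,R)$ and $R$ have the same (left) global dimension and the same (left) dominant dimension. Here the global dimension of a ring is the supremum of the projective dimensions of its left modules, and the dominant dimension of a ring $\Lambda$ is the supremum in $\mathbb N\cup\{\infty\}$ of all $m\ge 0$ such that the terms $I_0,\dots,I_{m-1}$ of the minimal injective resolution $0\to{}_\Lambda\Lambda\to I_0\to I_1\to\cdots$ are projective. (2) If $R$ is a semisimple ring, then $S_n(G,R)$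 is a semisimple ring. -/

import Mathlib

open CategoryTheory

universe u

/-- The centralizer matrix ring `S_n(C, R)`: the subring of `M_n(R)` of all matrices commuting
with every element of `C`. -/
def centralizerMatrixRing {R : Type u} [Ring R] {n : ℕ}
    (C : Set (Matrix (Fin n) (Fin n) R)) : Subring (Matrix (Fin n) (Fin n) R) :=
  Subring.centralizer C

/-- The ring `S_n(G, R)` for a subgroup `G` of `GL_n(R)`. -/
def groupCentralizerRing {R : Type u} [Ring R] {n : ℕ} (G : Subgroup (GL (Fin n) R)) :
    Subring (Matrix (Fin n) (Fin n) R) :=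
  centralizerMatrixRing ((fun g : GL (Fin n) R => (g : Matrix (Fin n) (Fin n) R)) '' (G : Set _))

/-- `i` is a `G`-free point: `g_{ii} = 0` for all `g ∈ G` different from the identity. -/
def IsFreePoint {R : Type u} [Ring R] {n : ℕ} (G : Subgroup (GL (Fin n) R)) (i : Fin n) : Prop :=
  ∀ g ∈ G, g ≠ 1 → (g : Matrix (Fin n) (Fin n) R) i i = 0

/-- The extension of rings `B ⊆ A` is a Frobenius extension: the left `B`-module `A` is finitely
generated and projective, and `A ≅ Hom_B(A, B)` as `A`-`B`-bimodules, where the bimodule structure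
of `Hom_B(A, B)` is `(a f b)(y) = f(y a) b`. -/
def IsFrobeniusExtension {A : Type u} [Ring A] (B : Subring A) : Prop :=
  Module.Finite B A ∧ Module.Projective B A ∧
    ∃ Φ : A ≃+ (A →ₗ[B] B), ∀ (a : A) (x : A) (b : B) (y : A),
      Φ (a * x * b) y = Φ x (y * a) * b

/-- The extension of rings `B ⊆ A` is split: `B` is a direct summand of `A` as a
`B`-`B`-bimodule, that is, it has a complement which is a sub-bimodule. -/
def IsSplitExtension {A : Type u} [Ring A] (B : Subring A) : Prop :=
  ∃ C : AddSubgroup A, (∀ b ∈ B, ∀ c ∈ C, b * c ∈ C ∧ c * b ∈ C) ∧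
    IsCompl B.toAddSubgroup C

/-- The (left) global dimension: the supremum of the projective dimensions of all left modules.
The zero module has projective dimension `⊥`, so the value is `⊥` exactly for the zero ring. -/
noncomputable def leftGlobalDimension (R : Type u) [Ring R] : WithBot ℕ∞ :=
  ⨆ M : ModuleCat.{u} R, projectiveDimension M

/-- `N` is an essential submodule: it meets every nonzero submodule nontrivially. -/
def IsEssentialSubmodule {R : Type u} [Ring R] {M : Type u} [AddCommGroup M] [Module R M]
    (N : Submodule R M) : Prop :=
  ∀ N' : Submodule R M, N ⊓ N' = ⊥ → N' = ⊥

/-- The sequence `0 → M → I 0 → I 1 → I 2 → ⋯` with augmentation `ε` and differentials `d` is a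
minimal injective resolution of `M`: it is exact, all `I k` are injective, and each `I k` is an
injective hull of the image of the map into it. -/
structure IsMinimalInjectiveResolution {R : Type u} [Ring R] {M : Type u} [AddCommGroup M]
    [Module R M] (I : ℕ → ModuleCat.{u} R) (ε : M →ₗ[R] I 0)
    (d : ∀ k : ℕ, I k →ₗ[R] I (k + 1)) : Prop where
  injective : ∀ k, Module.Injective R (I k)
  injective_augmentation : Function.Injective ε
  exact_zero : Function.Exact ε (d 0)
  exact_succ : ∀ k, Function.Exact (d k) (d (k + 1))
  essential_zero : IsEssentialSubmodule (LinearMap.range ε)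
  essential_succ : ∀ k, IsEssentialSubmodule (LinearMap.range (d k))

/-- The dominant dimension of a left module `M`: the supremum of all `m` such that the first `m`
terms `I 0, …, I (m - 1)` of the minimal injective resolution of `M` (which exists and is unique
up to isomorphism) are projective. -/
noncomputable def dominantDimension (R : Type u) [Ring R] (M : Type u) [AddCommGroup M]
    [Module R M] : ℕ∞ :=
  sSup {t : ℕ∞ | ∃ m : ℕ, t = m ∧
    ∃ (I : ℕ → ModuleCat.{u} R) (ε : M →ₗ[R] I 0) (d : ∀ k : ℕ, I k →ₗ[R] I (k + 1)),
      IsMinimalInjectiveResolution I ε d ∧ ∀ k < m, Module.Projective R (I k)}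

/-- The (left) dominant dimension of a ring `R`: that of the left regular module. -/
noncomputable def leftDominantDimension (R : Type u) [Ring R] : ℕ∞ :=
  dominantDimension R R

/-! Write `A` for the matrix ring and `S` for `groupCentralizerRing G`. Averaging without division,
`E a = ∑ g, g a g⁻¹`, is an `S`-`S`-bimodule map from `A` to `S`. If `i` is a free point, then `∑ p,
e_{pi} g e_{ip} = g_{ii} · 1` vanishes unless `g = 1`, so the matrix units `e_{pi}` and `e_{ip}` are
dual bases for `E`. This `FrobeniusSystem` yields the Frobenius property. Since `E 1 = |G|`, the map
`|G|⁻¹ E` is a bimodule projection onto `S`, so the extension splits; and `∑ p, e_{pi} e_{ip} = 1`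
makes it separable.

The dual bases also make coextension `Hom_S(A, -)` left adjoint to restriction, besides being right
adjoint to it. Both functors are therefore exact and preserve projectives and injectives. By
splitting and separability every module on either side is a retract of its round trip, which gives
equality of global dimensions.

For dominant dimension, minimality of the resolution is replaced by existence:
`HasDominantDimensionGE` asks for any exact start with injective projective terms. Injective hulls
show that this passes to retracts and agrees with the original definition. Then `A` is a retract of
`Hom_S(A, S)` and `S` is a retract of `A`, so the two functors carry the property both ways. Morita
equivalence replaces `A` by `R`. Semisimplicity descends because every `S`-module is a retract of
the restriction of a projective `A`-module. -/

/-! ### Projective dimension under exact functors. -/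

section ProjectiveDimensionTransfer

open Limits

universe v₁ u₁ v₂ u₂

variable {C : Type u₁} [Category.{v₁} C] [Abelian C] {D : Type u₂} [Category.{v₂} D] [Abelian D]

/-- An exact functor which preserves projective objects does not increase projective dimensions. -/
theorem hasProjectiveDimensionLT_obj [EnoughProjectives C] (F : C ⥤ D) [F.Additive]
    [PreservesFiniteLimits F] [PreservesFiniteColimits F] [F.PreservesProjectiveObjects]
    (n : ℕ) (X : C) (h : HasProjectiveDimensionLT X n) :
    HasProjectiveDimensionLT (F.obj X) n := by
  induction n generalizing X with
  | zero =>
    rw [hasProjectiveDimensionLT_zero_iff_isZero] at h ⊢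
    exact F.map_isZero h
  | succ n ih =>
    -- The syzygy criterion relates the bounds `n + 1` and `n + 2`, so the bound `1`, which is
    -- projectivity, needs its own case.
    cases n with
    | zero =>
      rw [← projective_iff_hasProjectiveDimensionLT_one] at h ⊢
      exact F.projective_obj X
    | succ n =>
      obtain ⟨p⟩ := EnoughProjectives.presentation X
      have hS : (ShortComplex.mk (kernel.ι p.f) p.f (kernel.condition p.f)).ShortExact :=
        { exact := ShortComplex.exact_kernel p.f }
      have h₁ := (hS.hasProjectiveDimensionLT_X₃_iff n p.projective).1 h
      exact ((hS.map_of_exact F).hasProjectiveDimensionLT_X₃_iff n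
        (F.projective_obj_of_projective p.projective)).2 (ih _ h₁)

theorem projectiveDimension_obj_le [EnoughProjectives C] (F : C ⥤ D) [F.Additive]
    [PreservesFiniteLimits F] [PreservesFiniteColimits F] [F.PreservesProjectiveObjects] (X : C) :
    projectiveDimension (F.obj X) ≤ projectiveDimension X :=
  sInf_le_sInf fun _ hm i hi => hasProjectiveDimensionLT_obj F i X (hm i hi)

/-- If `X` is a retract of an object in the image of an exact functor `C ⥤ D` preserving
projective objects, then its projective dimension is bounded by the supremum over `C`. -/
theorem projectiveDimension_le_iSup_of_retract [EnoughProjectives C] (F : C ⥤ D) [F.Additive]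
    [PreservesFiniteLimits F] [PreservesFiniteColimits F] [F.PreservesProjectiveObjects]
    {X : D} {Y : C} (h : Retract X (F.obj Y)) :
    projectiveDimension X ≤ ⨆ Y : C, projectiveDimension Y :=
  h.projectiveDimension_le.trans <| (projectiveDimension_obj_le F Y).trans <|
    le_iSup (fun Y : C => projectiveDimension Y) Y

end ProjectiveDimensionTransfer

/-! ### Dominant dimension without minimality, and its retracts. -/

section DominantDimensionTransfer

open Limits

universe v₁ u₁ v₂ u₂

variable {C : Type u₁} [Category.{v₁} C] [Abelian C] {D : Type u₂} [Category.{v₂} D] [Abelian D]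

/-- `X` admits an exact sequence `0 ⟶ X ⟶ I₀ ⟶ ⋯ ⟶ Iₘ₋₁` with all `Iₖ` injective and
projective. -/
inductive HasDominantDimensionGE : ℕ → C → Prop
  | zero (X : C) : HasDominantDimensionGE 0 X
  | succ {m : ℕ} (S : ShortComplex C) (hS : S.ShortExact) (hI : Injective S.X₂)
      (hP : Projective S.X₂) (h : HasDominantDimensionGE m S.X₃) :
      HasDominantDimensionGE (m + 1) S.X₁

theorem HasDominantDimensionGE.exists_shortExact {m : ℕ} {X : C}
    (h : HasDominantDimensionGE (m + 1) X) :
    ∃ (I Z : C) (f : X ⟶ I) (g : I ⟶ Z) (w : f ≫ g = 0), (ShortComplex.mk f g w).ShortExact ∧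
      Injective I ∧ Projective I ∧ HasDominantDimensionGE m Z := by
  cases h with
  | succ S hS hI hP h => exact ⟨S.X₂, S.X₃, S.f, S.g, S.zero, hS, hI, hP, h⟩

theorem HasDominantDimensionGE.obj (F : C ⥤ D) [F.Additive]
    [PreservesFiniteLimits F] [PreservesFiniteColimits F] [F.PreservesProjectiveObjects]
    [F.PreservesInjectiveObjects] {m : ℕ} {X : C} (h : HasDominantDimensionGE m X) :
    HasDominantDimensionGE m (F.obj X) := by
  induction h with
  | zero X => exact .zero _
  | succ S hS hI hP _ ih =>
    exact .succ (S.map F) (hS.map_of_exact F) (F.injective_obj_of_injective hI)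
      (F.projective_obj_of_projective hP) ih

/-- A morphism `i` is essential if `g` is a monomorphism as soon as `i ≫ g` is one. -/
def IsEssentialMorphism {X E : C} (i : X ⟶ E) : Prop :=
  ∀ ⦃W : C⦄ (g : E ⟶ W), Mono (i ≫ g) → Mono g

/-- If `X` is a retract of an object `Y` of dominant dimension at least `m + 1`, then an injective
hull of `X` is projective, and the cosyzygy of `X` is a retract of a cosyzygy of `Y`. -/
theorem HasDominantDimensionGE.exists_retract {m : ℕ} {Y : C}
    (h : HasDominantDimensionGE (m + 1) Y) {T : ShortComplex C} (r : Retract T.X₁ Y)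
    (hT : T.ShortExact) (hE : Injective T.X₂) (hess : IsEssentialMorphism T.f) :
    Projective T.X₂ ∧ ∃ Z : C, HasDominantDimensionGE m Z ∧ Nonempty (Retract T.X₃ Z) := by
  obtain ⟨I, Z, f, g, w, hS, hI, hP, hZ⟩ := h.exists_shortExact
  have := hS.mono_f
  have := hS.epi_g
  have := hT.mono_f
  have := hT.epi_g
  dsimp at *
  let a : T.X₂ ⟶ I := Injective.factorThru (r.i ≫ f) T.f
  have ha : T.f ≫ a = r.i ≫ f := Injective.comp_factorThru _ _
  let p : I ⟶ T.X₂ := Injective.factorThru (r.r ≫ T.f) f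
  have hp : f ≫ p = r.r ≫ T.f := Injective.comp_factorThru _ _
  have hap : T.f ≫ a ≫ p = T.f := by
    rw [reassoc_of% ha, hp, r.retract_assoc]
  -- `a ≫ p` restricts to the identity on `T.X₁`, so essentiality makes it mono; injectivity of
  -- `T.X₂` then supplies a left inverse `b`.
  have : Mono (a ≫ p) := hess _ (by rw [hap]; infer_instance)
  let b : T.X₂ ⟶ T.X₂ := Injective.factorThru (𝟙 _) (a ≫ p)
  have hb : (a ≫ p) ≫ b = 𝟙 _ := Injective.comp_factorThru _ _
  -- Since `b` also fixes `T.X₁`, the maps `a` and `p ≫ b` descend to the cokernels and exhibit the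
  -- retract there.
  have hfb : T.f ≫ b = T.f := by
    conv_lhs => rw [← hap]
    rw [Category.assoc, hb, Category.comp_id]
  have hE : Retract T.X₂ I := ⟨a, p ≫ b, by simpa using hb⟩
  refine ⟨hE.projective, Z, hZ, ⟨?_⟩⟩
  have h₁ : T.f ≫ a ≫ g = 0 := by rw [reassoc_of% ha, w, comp_zero]
  have h₂ : f ≫ p ≫ b ≫ T.g = 0 := by
    rw [reassoc_of% hp, reassoc_of% hfb, T.zero, comp_zero]
  refine ⟨hT.exact.desc (a ≫ g) h₁, hS.exact.desc (p ≫ b ≫ T.g) h₂, ?_⟩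
  rw [← cancel_epi T.g, hT.exact.g_desc_assoc, Category.assoc]
  erw [hS.exact.g_desc (p ≫ b ≫ T.g) h₂]
  rw [Category.comp_id, ← Category.assoc, ← Category.assoc, hb, Category.id_comp]

/-- The property `HasDominantDimensionGE m` passes to retracts if there are injective hulls. -/
theorem HasDominantDimensionGE.of_retract
    (hull : ∀ X : C, ∃ (E : C) (i : X ⟶ E), Mono i ∧ Injective E ∧ IsEssentialMorphism i)
    {m : ℕ} {X Y : C} (r : Retract X Y) (h : HasDominantDimensionGE m Y) :
    HasDominantDimensionGE m X := by
  induction m generalizing X Y with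
  | zero => exact .zero _
  | succ m ih =>
    obtain ⟨E, i, hi, hE, hess⟩ := hull X
    have hT : (ShortComplex.mk i (cokernel.π i) (cokernel.condition i)).ShortExact :=
      { exact := ShortComplex.exact_cokernel i }
    obtain ⟨hP, Z, hZ, ⟨r'⟩⟩ := h.exists_retract r hT hE hess
    exact .succ _ hT hE hP (ih r' hZ)

end DominantDimensionTransfer

/-! ### Existence of injective hulls. -/

section InjectiveHull

variable {R : Type u} [Ring R]

theorem IsEssentialSubmodule.injective_of_disjoint_ker {M W : Type u} [AddCommGroup M] [Module R M]
    [AddCommGroup W] [Module R W] {N : Submodule R M} (hN : IsEssentialSubmodule N)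
    (g : M →ₗ[R] W) (hg : ∀ x ∈ N, g x = 0 → x = 0) : Function.Injective g := by
  rw [← LinearMap.ker_eq_bot]
  refine hN _ ?_
  rw [eq_bot_iff]
  rintro x ⟨hx, hx'⟩
  exact hg x hx hx'

/-- Among the submodules of `I` in which `M` is essential there is a maximal one. -/
theorem exists_maximal_essential_extension {I : Type u} [AddCommGroup I] [Module R I]
    (M : Submodule R I) :
    ∃ H : Submodule R I, Maximal (fun H => M ≤ H ∧ ∀ N ≤ H, M ⊓ N = ⊥ → N = ⊥) H := by
  obtain ⟨H, -, hH⟩ := zorn_le_nonempty₀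
    {H : Submodule R I | M ≤ H ∧ ∀ N ≤ H, M ⊓ N = ⊥ → N = ⊥} (fun c hc hchain K hK => by
      refine ⟨sSup c, ⟨(hc hK).1.trans (le_sSup hK), fun N hN hMN => ?_⟩, fun H hH => le_sSup hH⟩
      rw [eq_bot_iff]
      intro x hx
      obtain ⟨H, hH, hxH⟩ :=
        (Submodule.mem_sSup_of_directed ⟨K, hK⟩ hchain.directedOn).1 (hN hx)
      have : R ∙ x = ⊥ := (hc hH).2 _ (by simpa using hxH) (by
        rw [eq_bot_iff, ← hMN]
        exact inf_le_inf_left _ (by simpa using hx))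
      simpa using this) M ⟨le_rfl, fun N hN hMN => by rwa [inf_eq_right.2 hN] at hMN⟩
  exact ⟨H, hH⟩

/-- A maximal essential extension inside an injective module is injective. -/
theorem injective_of_maximal_essential_extension {I : Type u} [AddCommGroup I] [Module R I]
    (hI : Module.Injective R I) {M H : Submodule R I}
    (hH : Maximal (fun H => M ≤ H ∧ ∀ N ≤ H, M ⊓ N = ⊥ → N = ⊥) H) :
    Module.Injective R H := by
  -- A maximal `K` with `H ⊓ K = ⊥` makes `H` embed essentially into `I ⧸ K`.
  obtain ⟨K, -, hK⟩ := zorn_le_nonempty₀ {K : Submodule R I | H ⊓ K = ⊥}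
    (fun c hc hchain K₀ hK₀ => by
      refine ⟨sSup c, ?_, fun K hK => le_sSup hK⟩
      refine eq_bot_iff.2 ?_
      rintro x ⟨hxH, hx⟩
      obtain ⟨K, hK, hxK⟩ := (Submodule.mem_sSup_of_directed ⟨K₀, hK₀⟩ hchain.directedOn).1 hx
      rw [← (hc hK : H ⊓ K = ⊥)]
      exact ⟨hxH, hxK⟩) ⊥ (by simp)
  have hdisj : H ⊓ K = ⊥ := hK.1
  let q : H →ₗ[R] I ⧸ K := K.mkQ ∘ₗ H.subtype
  have hq : Function.Injective q := by
    rw [← LinearMap.ker_eq_bot, eq_bot_iff]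
    intro x hx
    have hxK : (x : I) ∈ K := by simpa [q] using hx
    have : (x : I) ∈ H ⊓ K := ⟨x.2, hxK⟩
    rw [hdisj] at this
    simpa using this
  have hess : IsEssentialSubmodule (LinearMap.range q) := by
    intro N hN
    have hKN : K ≤ N.comap K.mkQ := fun x hx => by
      have : K.mkQ x = 0 := by simpa using hx
      simp [Submodule.mem_comap, this]
    have : H ⊓ N.comap K.mkQ = ⊥ := by
      rw [eq_bot_iff]
      rintro x ⟨hxH, hxN⟩
      have h : q ⟨x, hxH⟩ ∈ LinearMap.range q ⊓ N := ⟨⟨_, rfl⟩, hxN⟩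
      rw [hN, Submodule.mem_bot] at h
      have := hq (h.trans q.map_zero.symm)
      simpa using this
    have hle : N.comap K.mkQ ≤ K := hK.2 this hKN
    rw [eq_bot_iff]
    intro y hy
    obtain ⟨x, rfl⟩ := K.mkQ_surjective y
    simpa using hle hy
  -- Extend the inclusion of `H` along `q`. The extension `ψ` is injective because `q` is essential,
  -- so its range is an essential extension of `M` containing `H`; maximality forces equality, and
  -- `ψ ∘ₗ K.mkQ` retracts `I` onto `H`.
  obtain ⟨ψ, hψ⟩ := hI.out q hq H.subtype
  have hψi : Function.Injective ψ := hess.injective_of_disjoint_ker ψ (by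
    rintro _ ⟨x, rfl⟩ hx
    rw [hψ] at hx
    have : x = 0 := by simpa using hx
    rw [this, map_zero])
  have hHψ : H ≤ LinearMap.range ψ := fun x hx => ⟨q ⟨x, hx⟩, hψ _⟩
  have hψH : LinearMap.range ψ ≤ H := by
    refine hH.2 ⟨hH.1.1.trans hHψ, fun N hN hMN => ?_⟩ hHψ
    have hHN : H ⊓ N = ⊥ := hH.1.2 _ inf_le_left (by
      rw [eq_bot_iff, ← hMN]
      exact inf_le_inf_left _ inf_le_right)
    have : N.comap ψ = ⊥ := by
      refine hess _ ?_
      rw [eq_bot_iff]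
      rintro _ ⟨⟨x, rfl⟩, hx⟩
      have h : (x : I) ∈ H ⊓ N := ⟨x.2, by simpa [hψ] using hx⟩
      rw [hHN] at h
      have : x = 0 := by simpa using h
      simp [this]
    rw [eq_bot_iff]
    intro y hy
    obtain ⟨z, rfl⟩ := hN hy
    have hz : z ∈ N.comap ψ := hy
    rw [this] at hz
    simp [(Submodule.mem_bot R).1 hz]
  let p : I →ₗ[R] H := (ψ ∘ₗ K.mkQ).codRestrict H fun x => hψH ⟨_, rfl⟩
  have hp : ∀ x : H, p x = x := fun x => Subtype.ext (hψ x)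
  refine ⟨fun X Y _ _ _ _ f hf g => ?_⟩
  obtain ⟨h, hh⟩ := hI.out f hf (H.subtype ∘ₗ g)
  exact ⟨p ∘ₗ h, fun x => by simp [hh, hp]⟩

/-- Every module has an injective hull. -/
theorem exists_injective_hull (M : Type u) [AddCommGroup M] [Module R M] :
    ∃ (E : ModuleCat.{u} R) (i : M →ₗ[R] E), Function.Injective i ∧ Module.Injective R E ∧
      IsEssentialSubmodule (LinearMap.range i) := by
  let P := Classical.choice (EnoughInjectives.presentation (ModuleCat.of R M))
  have hJ : Module.Injective R P.J := (Module.injective_iff_injective_object R P.J).2 P.injective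
  have hf : Function.Injective P.f := (ModuleCat.mono_iff_injective P.f).1 P.mono
  obtain ⟨H, hH⟩ := exists_maximal_essential_extension (LinearMap.range P.f.hom)
  refine ⟨ModuleCat.of R H, P.f.hom.codRestrict H fun x => hH.1.1 ⟨x, rfl⟩, ?_,
    injective_of_maximal_essential_extension hJ hH, fun N hN => ?_⟩
  · exact fun x y hxy => hf (congrArg Subtype.val hxy)
  · have : N.map H.subtype = ⊥ := hH.1.2 _ (Submodule.map_subtype_le _ _) (by
      rw [eq_bot_iff]
      rintro _ ⟨⟨x, rfl⟩, ⟨y, hy, hxy⟩⟩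
      have : y ∈ LinearMap.range (P.f.hom.codRestrict H fun x => hH.1.1 ⟨x, rfl⟩) ⊓ N :=
        ⟨⟨x, Subtype.ext hxy.symm⟩, hy⟩
      rw [hN, Submodule.mem_bot] at this
      rw [Submodule.mem_bot]
      refine hxy.symm.trans ?_
      rw [this]
      rfl)
    exact Submodule.map_injective_of_injective H.subtype_injective (by rw [this, Submodule.map_bot])

theorem IsEssentialSubmodule.isEssentialMorphism {X E : ModuleCat.{u} R} (i : X ⟶ E)
    (h : IsEssentialSubmodule (LinearMap.range i.hom)) : IsEssentialMorphism i := by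
  intro W g hg
  rw [ModuleCat.mono_iff_injective] at hg ⊢
  refine h.injective_of_disjoint_ker g.hom ?_
  rintro _ ⟨x, rfl⟩ hx
  have : x = 0 := hg (by simpa using hx)
  simp [this]

theorem ModuleCat.exists_injective_hull (X : ModuleCat.{u} R) :
    ∃ (E : ModuleCat.{u} R) (i : X ⟶ E), Mono i ∧ Injective E ∧ IsEssentialMorphism i := by
  obtain ⟨E, i, hi, hE, hess⟩ := _root_.exists_injective_hull (R := R) X
  exact ⟨E, ModuleCat.ofHom i, (ModuleCat.mono_iff_injective _).2 hi,
    (Module.injective_iff_injective_object R E).1 hE,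
    IsEssentialSubmodule.isEssentialMorphism _ hess⟩

theorem ModuleCat.hasDominantDimensionGE_of_retract {m : ℕ} {X Y : ModuleCat.{u} R}
    (r : Retract X Y) (h : HasDominantDimensionGE m Y) : HasDominantDimensionGE m X :=
  h.of_retract ModuleCat.exists_injective_hull r

end InjectiveHull

/-! ### Minimal injective resolutions and dominant dimension. -/

section MinimalResolution

variable {R : Type u} [Ring R]

/-- The injective hull of a module. -/
noncomputable def injectiveHull (M : ModuleCat.{u} R) : ModuleCat.{u} R :=
  (exists_injective_hull (R := R) M).choose

/-- The inclusion of a module into its injective hull. -/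
noncomputable def injectiveHullMap (M : ModuleCat.{u} R) : M →ₗ[R] injectiveHull M :=
  (exists_injective_hull (R := R) M).choose_spec.choose

theorem injectiveHull_spec (M : ModuleCat.{u} R) : Function.Injective (injectiveHullMap M) ∧
    Module.Injective R (injectiveHull M) ∧
      IsEssentialSubmodule (LinearMap.range (injectiveHullMap M)) :=
  (exists_injective_hull (R := R) M).choose_spec.choose_spec

/-- The cokernel of the inclusion of a module into its injective hull. -/
noncomputable def cosyzygy (M : ModuleCat.{u} R) : ModuleCat.{u} R :=
  ModuleCat.of R (injectiveHull M ⧸ LinearMap.range (injectiveHullMap M))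

/-- The projection from the injective hull onto the cosyzygy. -/
noncomputable def cosyzygyMap (M : ModuleCat.{u} R) : injectiveHull M →ₗ[R] cosyzygy M :=
  (LinearMap.range (injectiveHullMap M)).mkQ

theorem cosyzygyMap_surjective (M : ModuleCat.{u} R) : Function.Surjective (cosyzygyMap M) :=
  Submodule.mkQ_surjective _

theorem exact_injectiveHullMap_cosyzygyMap (M : ModuleCat.{u} R) :
    Function.Exact (injectiveHullMap M) (cosyzygyMap M) :=
  LinearMap.exact_map_mkQ_range _

/-- The iterated cosyzygies of a module. -/
noncomputable def iteratedCosyzygy (M : ModuleCat.{u} R) : ℕ → ModuleCat.{u} R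
  | 0 => M
  | k + 1 => cosyzygy (iteratedCosyzygy M k)

/-- The differentials of the minimal injective resolution. -/
noncomputable def minimalResolutionMap (M : ModuleCat.{u} R) (k : ℕ) :
    injectiveHull (iteratedCosyzygy M k) →ₗ[R] injectiveHull (iteratedCosyzygy M (k + 1)) :=
  injectiveHullMap (iteratedCosyzygy M (k + 1)) ∘ₗ cosyzygyMap (iteratedCosyzygy M k)

theorem ker_minimalResolutionMap (M : ModuleCat.{u} R) (k : ℕ)
    (x : injectiveHull (iteratedCosyzygy M k)) :
    minimalResolutionMap M k x = 0 ↔ cosyzygyMap (iteratedCosyzygy M k) x = 0 :=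
  map_eq_zero_iff _ (injectiveHull_spec (iteratedCosyzygy M (k + 1))).1

theorem range_minimalResolutionMap (M : ModuleCat.{u} R) (k : ℕ) :
    LinearMap.range (minimalResolutionMap M k) =
      LinearMap.range (injectiveHullMap (iteratedCosyzygy M (k + 1))) :=
  LinearMap.range_comp_of_range_eq_top _
    (LinearMap.range_eq_top.2 (cosyzygyMap_surjective (iteratedCosyzygy M k)))

theorem isMinimalInjectiveResolution_injectiveHull (M : ModuleCat.{u} R) :
    IsMinimalInjectiveResolution (fun k => injectiveHull (iteratedCosyzygy M k))
      (injectiveHullMap M) (minimalResolutionMap M) where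
  injective k := (injectiveHull_spec _).2.1
  injective_augmentation := (injectiveHull_spec M).1
  exact_zero x := (ker_minimalResolutionMap M 0 x).trans (exact_injectiveHullMap_cosyzygyMap M x)
  exact_succ k x := by
    rw [ker_minimalResolutionMap, ← LinearMap.coe_range, range_minimalResolutionMap]
    exact exact_injectiveHullMap_cosyzygyMap _ x
  essential_zero := (injectiveHull_spec M).2.2
  essential_succ k := by
    rw [range_minimalResolutionMap]
    exact (injectiveHull_spec _).2.2

theorem shortExact_injectiveHull (M : ModuleCat.{u} R) :
    ∃ w, (ShortComplex.mk (ModuleCat.ofHom (injectiveHullMap M))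
      (ModuleCat.ofHom (cosyzygyMap M)) w).ShortExact :=
  ⟨by ext x; exact (exact_injectiveHullMap_cosyzygyMap M).apply_apply_eq_zero x,
    { exact := (ShortComplex.ShortExact.moduleCat_exact_iff_function_exact _).2
        (exact_injectiveHullMap_cosyzygyMap M)
      mono_f := (ModuleCat.mono_iff_injective _).2 (injectiveHull_spec M).1
      epi_g := (ModuleCat.epi_iff_surjective _).2 (cosyzygyMap_surjective M) }⟩

/-- This is `exists_retract` for the trivial retract: the hull is a summand of any injective
containing `M`, and its cosyzygy is a summand of the corresponding cokernel. -/
theorem HasDominantDimensionGE.projective_injectiveHull {m : ℕ} {M : ModuleCat.{u} R}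
    (h : HasDominantDimensionGE (m + 1) M) :
    Module.Projective R (injectiveHull M) ∧ HasDominantDimensionGE m (cosyzygy M) := by
  obtain ⟨w, hT⟩ := shortExact_injectiveHull M
  obtain ⟨hP, Z, hZ, ⟨r⟩⟩ := h.exists_retract (Retract.refl M) hT
    ((Module.injective_iff_injective_object R _).1 (injectiveHull_spec M).2.1)
    (IsEssentialSubmodule.isEssentialMorphism _ (injectiveHull_spec M).2.2)
  exact ⟨(IsProjective.iff_projective _).2 hP, ModuleCat.hasDominantDimensionGE_of_retract r hZ⟩

theorem HasDominantDimensionGE.projective_minimalResolution {m : ℕ} {M : ModuleCat.{u} R}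
    (h : HasDominantDimensionGE m M) (k : ℕ) (hk : k < m) :
    Module.Projective R (injectiveHull (iteratedCosyzygy M k)) := by
  have key : ∀ k j, HasDominantDimensionGE (j + k) M →
      HasDominantDimensionGE j (iteratedCosyzygy M k) := by
    intro k
    induction k with
    | zero => exact fun j h => h
    | succ k ih => exact fun j h => (ih (j + 1) (by rwa [add_assoc, add_comm 1 k])
        ).projective_injectiveHull.2
  obtain ⟨j, rfl⟩ := Nat.exists_eq_add_of_lt hk
  exact (key k (j + 1) (by rwa [show j + 1 + k = k + j + 1 by omega])).projective_injectiveHull.1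

/-- A minimal injective resolution whose first `m` terms are projective bounds the dominant
dimension from below. -/
theorem IsMinimalInjectiveResolution.hasDominantDimensionGE (m : ℕ) {M : Type u} [AddCommGroup M]
    [Module R M] {I : ℕ → ModuleCat.{u} R} {ε : M →ₗ[R] I 0} {d : ∀ k : ℕ, I k →ₗ[R] I (k + 1)}
    (h : IsMinimalInjectiveResolution I ε d) (hP : ∀ k < m, Module.Projective R (I k)) :
    HasDominantDimensionGE m (ModuleCat.of R M) := by
  induction m generalizing M I with
  | zero => exact .zero _
  | succ m ih =>
    -- Dropping the first term leaves a minimal injective resolution of the first cosyzygy, realised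
    -- as this range.
    let N := LinearMap.range (d 0)
    have hN : IsMinimalInjectiveResolution (fun k => I (k + 1)) N.subtype
        (fun k => d (k + 1)) :=
      { injective := fun k => h.injective (k + 1)
        injective_augmentation := N.subtype_injective
        exact_zero := fun x => by
          simpa [N] using h.exact_succ 0 x
        exact_succ := fun k => h.exact_succ (k + 1)
        essential_zero := by simpa [N] using h.essential_succ 0
        essential_succ := fun k => h.essential_succ (k + 1) }
    have hZ := ih hN fun k hk => hP (k + 1) (by omega)
    let S : ShortComplex (ModuleCat.{u} R) :=
      ShortComplex.mk (X₁ := ModuleCat.of R M) (X₃ := ModuleCat.of R N)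
        (ModuleCat.ofHom ε) (ModuleCat.ofHom (d 0).rangeRestrict) (by
          ext x
          exact h.exact_zero.apply_apply_eq_zero x)
    have hS : S.ShortExact :=
      { exact := (ShortComplex.ShortExact.moduleCat_exact_iff_function_exact _).2 fun x => by
          refine Iff.trans ?_ (h.exact_zero x)
          exact Subtype.ext_iff
        mono_f := (ModuleCat.mono_iff_injective _).2 h.injective_augmentation
        epi_g := (ModuleCat.epi_iff_surjective _).2 (d 0).surjective_rangeRestrict }
    exact .succ S hS ((Module.injective_iff_injective_object R _).1 (h.injective 0))
      ((IsProjective.iff_projective _).1 (hP 0 (by omega))) hZ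

/-- Any exact start with injective projective terms forces the minimal one to have projective terms,
so minimality can be dropped. -/
theorem dominantDimension_eq_sSup (M : Type u) [AddCommGroup M] [Module R M] :
    dominantDimension R M =
      sSup {t : ℕ∞ | ∃ m : ℕ, t = m ∧ HasDominantDimensionGE m (ModuleCat.of R M)} := by
  unfold dominantDimension
  congr 1
  ext t
  refine exists_congr fun m => and_congr_right fun _ => ⟨?_, fun h => ?_⟩
  · rintro ⟨I, ε, d, h, hP⟩
    exact h.hasDominantDimensionGE m hP
  · exact ⟨_, _, _, isMinimalInjectiveResolution_injectiveHull (ModuleCat.of R M),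
      h.projective_minimalResolution⟩

theorem leftDominantDimension_congr {S : Type u} [Ring S]
    (h : ∀ m, HasDominantDimensionGE m (ModuleCat.of R R) ↔
      HasDominantDimensionGE m (ModuleCat.of S S)) :
    leftDominantDimension R = leftDominantDimension S := by
  simp only [leftDominantDimension, dominantDimension_eq_sSup, h]

end MinimalResolution

/-! ### Functors with the same adjoint on both sides. -/

section Biadjoint

open Limits

universe v₁ u₁ v₂ u₂

variable {C : Type u₁} [Category.{v₁} C] [Abelian C] {D : Type u₂} [Category.{v₂} D] [Abelian D]

theorem projectiveDimension_le_iSup_of_biadjoint [EnoughProjectives C] {F : C ⥤ D} {G : D ⥤ C}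
    (adj₁ : F ⊣ G) (adj₂ : G ⊣ F) [F.Additive] {X : D} {Y : C} (h : Retract X (F.obj Y)) :
    projectiveDimension X ≤ ⨆ Y : C, projectiveDimension Y := by
  have := adj₁.leftAdjoint_preservesColimits
  have := adj₂.leftAdjoint_preservesColimits
  have := adj₂.rightAdjoint_preservesLimits
  have := PreservesColimits.preservesFiniteColimits F
  have := PreservesLimits.preservesFiniteLimits F
  have : F.PreservesProjectiveObjects := ⟨fun hX => adj₁.map_projective _ hX⟩
  exact projectiveDimension_le_iSup_of_retract F h

theorem iSup_projectiveDimension_eq_of_biadjoint [EnoughProjectives C] [EnoughProjectives D]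
    {F : C ⥤ D} {G : D ⥤ C} (adj₁ : F ⊣ G) (adj₂ : G ⊣ F) [F.Additive]
    (hC : ∀ X : C, Nonempty (Retract X (G.obj (F.obj X))))
    (hD : ∀ X : D, Nonempty (Retract X (F.obj (G.obj X)))) :
    ⨆ X : D, projectiveDimension X = ⨆ X : C, projectiveDimension X := by
  have : G.Additive := adj₁.right_adjoint_additive
  exact le_antisymm
    (iSup_le fun X => projectiveDimension_le_iSup_of_biadjoint adj₁ adj₂ (hD X).some)
    (iSup_le fun X => projectiveDimension_le_iSup_of_biadjoint adj₂ adj₁ (hC X).some)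

theorem HasDominantDimensionGE.obj_of_biadjoint {F : C ⥤ D} {G : D ⥤ C}
    (adj₁ : F ⊣ G) (adj₂ : G ⊣ F) [F.Additive] {m : ℕ} {X : C} (h : HasDominantDimensionGE m X) :
    HasDominantDimensionGE m (F.obj X) := by
  have := adj₁.leftAdjoint_preservesColimits
  have := adj₂.leftAdjoint_preservesColimits
  have := adj₁.rightAdjoint_preservesLimits
  have := adj₂.rightAdjoint_preservesLimits
  have := PreservesColimits.preservesFiniteColimits F
  have := PreservesLimits.preservesFiniteLimits F
  have : F.PreservesProjectiveObjects := ⟨fun hX => adj₁.map_projective _ hX⟩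
  have : F.PreservesInjectiveObjects := ⟨fun hX => adj₂.map_injective _ hX⟩
  exact h.obj F

end Biadjoint

/-! ### Frobenius systems and their module categories. -/

section FrobeniusSystem

variable {A : Type u} [Ring A]

/-- A Frobenius system for a subring `S` of `A`: a homomorphism of `S`-`S`-bimodules `A → S`
together with dual bases. -/
structure FrobeniusSystem (S : Subring A) (ι : Type) [Fintype ι] where
  toHom : A →+ S
  map_mul_left : ∀ (s : S) (a : A), toHom (s * a) = s * toHom a
  map_mul_right : ∀ (a : A) (s : S), toHom (a * s) = toHom a * s
  x : ι → A
  y : ι → A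
  sum_left : ∀ a, ∑ j, x j * (toHom (y j * a) : A) = a
  sum_right : ∀ a, ∑ j, (toHom (a * x j) : A) * y j = a

namespace FrobeniusSystem

variable {S : Subring A} {ι : Type} [Fintype ι] (Φ : FrobeniusSystem S ι)

theorem sum_smul (a : A) : ∑ j, Φ.toHom (a * Φ.x j) • Φ.y j = a := Φ.sum_right a

theorem map_sum {N : Type*} [AddCommGroup N] [Module S N] (f : A →ₗ[S] N) (a : A) :
    ∑ j, Φ.toHom (a * Φ.x j) • f (Φ.y j) = f a := by
  conv_rhs => rw [← Φ.sum_smul a]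
  simp only [_root_.map_sum, map_smul]

/-- The Casimir property of the dual bases. -/
theorem sum_smul_map_mul {M : Type*} [AddCommGroup M] [Module A M] (f : A →ₗ[S] M) (a : A) :
    ∑ j, Φ.x j • f (Φ.y j * a) = a • ∑ j, Φ.x j • f (Φ.y j) := by
  calc ∑ j, Φ.x j • f (Φ.y j * a)
      = ∑ j, ∑ k, (Φ.x j * (Φ.toHom (Φ.y j * (a * Φ.x k)) : A)) • f (Φ.y k) := by
        refine Finset.sum_congr rfl fun j _ => ?_
        -- Expand `y j * a` in the `y k`; after swapping sums, `sum_left` collapses the sum over `j`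
        -- to `a * x k`.
        rw [← Φ.map_sum f (Φ.y j * a), Finset.smul_sum]
        refine Finset.sum_congr rfl fun k _ => ?_
        rw [mul_smul, mul_assoc]
        rfl
    _ = ∑ k, (a * Φ.x k) • f (Φ.y k) := by
        rw [Finset.sum_comm]
        refine Finset.sum_congr rfl fun k _ => ?_
        rw [← Finset.sum_smul, Φ.sum_left]
    _ = a • ∑ j, Φ.x j • f (Φ.y j) := by
        simp only [Finset.smul_sum, mul_smul]

/-- The pairing `x ↦ (y ↦ E (y x))`. -/
def toDual (a : A) : A →ₗ[S] S where
  toFun y := Φ.toHom (y * a)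
  map_add' y z := by rw [add_mul, map_add]
  map_smul' s y := by
    rw [Subring.smul_def, smul_eq_mul, mul_assoc, Φ.map_mul_left]
    rfl

/-- The dual basis lemma gives finiteness and projectivity; the inverse of `a ↦ E(· a)` is `f ↦ ∑ j,
x j * f (y j)`. -/
theorem isFrobeniusExtension (Φ : FrobeniusSystem S ι) : IsFrobeniusExtension S := by
  refine ⟨?_, ?_, ?_⟩
  · classical
    refine ⟨⟨Finset.univ.image Φ.y, ?_⟩⟩
    rw [eq_top_iff]
    rintro a -
    rw [← Φ.sum_smul a]
    exact Submodule.sum_mem _ fun j _ => Submodule.smul_mem _ _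
      (Submodule.subset_span (by simp))
  · refine Module.Projective.of_split (M := ι → S)
      (LinearMap.pi fun j => Φ.toDual (Φ.x j)) (Fintype.linearCombination S Φ.y) ?_
    ext a
    simpa [Fintype.linearCombination_apply] using! Φ.sum_smul a
  · refine ⟨{ toFun := Φ.toDual
              invFun := fun f => ∑ j, Φ.x j * (f (Φ.y j) : A)
              left_inv := fun a => Φ.sum_left a
              right_inv := fun f => ?_
              map_add' := fun a b => ?_ }, fun a x b y => ?_⟩
    · ext a
      change ((Φ.toHom (a * _) : S) : A) = _
      rw [← Φ.map_sum f a, Finset.mul_sum, _root_.map_sum]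
      congr 1
      refine Finset.sum_congr rfl fun j _ => ?_
      rw [← mul_assoc, Φ.map_mul_right]
      rfl
    · ext y
      change ((Φ.toHom (y * (a + b)) : S) : A) = _
      rw [mul_add, map_add]
      rfl
    · change Φ.toHom (y * (a * x * b)) = Φ.toHom (y * a * x) * b
      rw [← Φ.map_mul_right]
      simp only [mul_assoc]

/-- The map `c E` is a bimodule projection onto `S`, and its kernel is the complement. -/
theorem isSplitExtension (Φ : FrobeniusSystem S ι) (c : S) (hc : ∀ s : S, s * c = c * s) (h : c * Φ.toHom 1 = 1) :
    IsSplitExtension S := by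
  let p : A →+ S := (AddMonoidHom.mulLeft c).comp Φ.toHom
  have hp : ∀ s : S, p s = s := fun s => by
    change c * Φ.toHom s = s
    rw [← mul_one (s : A), Φ.map_mul_left, ← mul_assoc, ← hc, mul_assoc, h, mul_one]
  refine ⟨p.ker, fun b hb a ha => ⟨?_, ?_⟩, ?_, ?_⟩
  · change c * Φ.toHom ((⟨b, hb⟩ : S) * a) = 0
    rw [Φ.map_mul_left, ← mul_assoc, ← hc, mul_assoc, show c * Φ.toHom a = 0 from ha, mul_zero]
  · change c * Φ.toHom (a * (⟨b, hb⟩ : S)) = 0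
    rw [Φ.map_mul_right, ← mul_assoc, show c * Φ.toHom a = 0 from ha, zero_mul]
  · rw [disjoint_iff, eq_bot_iff]
    rintro b ⟨hb, hbp⟩
    have : (⟨b, hb⟩ : S) = 0 := (hp ⟨b, hb⟩).symm.trans hbp
    exact congrArg Subtype.val this
  · rw [codisjoint_iff, eq_top_iff]
    rintro a -
    rw [← add_sub_cancel (p a : A) a]
    refine AddSubgroup.add_mem_sup (p a).2 ?_
    rw [AddMonoidHom.mem_ker, map_sub, hp, sub_self]

open ModuleCat

/-- The map `N → Hom_S(A, N)` sending `n` to `a ↦ E(a) n`. -/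
def unitMap (N : Type u) [AddCommGroup N] [Module S N] : N →+ (A →ₗ[S] N) where
  toFun n :=
    { toFun := fun a => Φ.toHom a • n
      map_add' := fun a b => by rw [map_add, add_smul]
      map_smul' := fun s a => by
        rw [Subring.smul_def, smul_eq_mul, Φ.map_mul_left, mul_smul]
        rfl }
  map_zero' := LinearMap.ext fun a => smul_zero _
  map_add' n n' := LinearMap.ext fun a => smul_add _ _ _

/-- The map `Hom_S(A, M) → M` sending `f` to `∑ j, x j • f (y j)`. -/
def counitMap (M : Type u) [AddCommGroup M] [Module A M] : (A →ₗ[S] M) →+ M where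
  toFun f := ∑ j, Φ.x j • f (Φ.y j)
  map_zero' := by simp
  map_add' f g := by simp [Finset.sum_add_distrib]

theorem counitMap_of_comp {M M' : Type u} [AddCommGroup M] [Module A M] [AddCommGroup M']
    [Module A M'] (g : M →ₗ[A] M') (f : A →ₗ[S] M) (f' : A →ₗ[S] M') (h : ∀ a, f' a = g (f a)) :
    Φ.counitMap M' f' = g (Φ.counitMap M f) := by
  simp [counitMap, h]

theorem counitMap_unitMap (M : Type u) [AddCommGroup M] [Module A M] (m : M) :
    Φ.counitMap M (Φ.unitMap M m) = m := by
  change ∑ j, Φ.x j • (Φ.toHom (Φ.y j) : A) • m = m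
  have := Φ.sum_left 1
  simp only [mul_one] at this
  simp only [← mul_smul, ← Finset.sum_smul, this, one_smul]

/-- An element of `Hom_S(A, N)` as a linear map. -/
noncomputable def coextendEquiv (N : ModuleCat.{u} S) :
    (coextendScalars S.subtype).obj N ≃+ (A →ₗ[S] N) where
  toFun f :=
    { toFun := fun a => CoextendScalars.equiv S.subtype N f a
      map_add' := fun a b => map_add (CoextendScalars.equiv S.subtype N f) a b
      map_smul' := fun s a => map_smul (CoextendScalars.equiv S.subtype N f) s a }
  invFun f := (CoextendScalars.equiv S.subtype N).symm
    { toFun := fun a => f a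
      map_add' := fun a b => map_add f a b
      map_smul' := fun s a => map_smul f s a }
  left_inv _ := rfl
  right_inv _ := rfl
  map_add' _ _ := rfl

theorem coextendEquiv_smul (N : ModuleCat.{u} S) (a b : A)
    (f : (coextendScalars S.subtype).obj N) :
    coextendEquiv N (a • f) b = coextendEquiv N f (b * a) := rfl

/-- Left triangle identity: evaluated at `b`, the sum is `∑ j, E(b x j) f(y j) = f b`. -/
theorem counitMap_coextend (N : ModuleCat.{u} S) (f : (coextendScalars S.subtype).obj N)
    (h : A →ₗ[S] (coextendScalars S.subtype).obj N)
    (hh : ∀ a, h a = (coextendEquiv N).symm (Φ.unitMap N (coextendEquiv N f a))) :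
    Φ.counitMap ((coextendScalars S.subtype).obj N) h = f := by
  refine (coextendEquiv N).injective (LinearMap.ext fun b : A => ?_)
  change coextendEquiv N (∑ j, Φ.x j • h (Φ.y j)) b = _
  rw [_root_.map_sum, LinearMap.sum_apply, ← Φ.map_sum (coextendEquiv N f) b]
  refine Finset.sum_congr rfl fun j _ => ?_
  rw [coextendEquiv_smul, hh, AddEquiv.apply_symm_apply]
  rfl

/-- The unit of the adjunction between coextension and restriction of scalars. -/
noncomputable def unitApp (N : ModuleCat.{u} S) :
    N ⟶ (coextendScalars S.subtype ⋙ restrictScalars S.subtype).obj N :=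
  ofHom (Y := (restrictScalars S.subtype).obj ((coextendScalars S.subtype).obj N))
    { toFun := fun n => (coextendEquiv N).symm (Φ.unitMap N n)
      map_add' := fun n n' => by
        rw [map_add, map_add]
        rfl
      map_smul' := fun s n => (coextendEquiv N).injective (LinearMap.ext fun a : A => by
        change Φ.toHom a • s • n = Φ.toHom (a * s) • n
        rw [Φ.map_mul_right, mul_smul]) }

/-- The counit of the adjunction between coextension and restriction of scalars. -/
noncomputable def counitApp (M : ModuleCat.{u} A) :
    (restrictScalars S.subtype ⋙ coextendScalars S.subtype).obj M ⟶ M :=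
  ofHom (X := (coextendScalars S.subtype).obj ((restrictScalars S.subtype).obj M))
    { toFun := fun f => Φ.counitMap M (coextendEquiv ((restrictScalars S.subtype).obj M) f)
      map_add' := fun f g => map_add (Φ.counitMap M)
        (coextendEquiv ((restrictScalars S.subtype).obj M) f)
        (coextendEquiv ((restrictScalars S.subtype).obj M) g)
      map_smul' := fun a f => Φ.sum_smul_map_mul (M := M)
        (coextendEquiv ((restrictScalars S.subtype).obj M) f) a }

/-- For a Frobenius extension, coextension of scalars is left adjoint to restriction. -/
noncomputable def coextendRestrictAdj :
    coextendScalars.{u, u, u} S.subtype ⊣ restrictScalars.{u, u, u} S.subtype :=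
  Adjunction.mkOfUnitCounit
    { unit :=
        { app := Φ.unitApp
          naturality := fun N N' g => by
            ext n
            refine (coextendEquiv N').injective (LinearMap.ext fun a : A => ?_)
            exact (map_smul g.hom (Φ.toHom a) n).symm }
      counit :=
        { app := Φ.counitApp
          naturality := fun M M' g => by
            ext f
            exact Φ.counitMap_of_comp g.hom
              (coextendEquiv ((restrictScalars S.subtype).obj M) f) _ fun a => rfl }
      left_triangle := by
        ext N f
        exact Φ.counitMap_coextend N f _ fun a => rfl
      right_triangle := by
        ext M m
        exact Φ.counitMap_unitMap M m }

/-- For a separable Frobenius extension, every `A`-module `M` is a retract of `Hom_S(A, M)`. -/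
noncomputable def retractCoextend (h : ∑ j, Φ.x j * Φ.y j = 1) (M : ModuleCat.{u} A) :
    Retract M ((coextendScalars S.subtype).obj ((restrictScalars S.subtype).obj M)) where
  i := (restrictCoextendScalarsAdj S.subtype).unit.app M
  r := Φ.counitApp M
  retract := by
    ext m
    change ∑ j, Φ.x j • Φ.y j • m = m
    simp only [← mul_smul, ← Finset.sum_smul, h, one_smul]

/-- For a split Frobenius extension, every `S`-module `N` is a retract of `Hom_S(A, N)`. -/
noncomputable def retractRestrict (c : S) (hc : ∀ s : S, s * c = c * s) (h : c * Φ.toHom 1 = 1)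
    (N : ModuleCat.{u} S) :
    Retract N ((restrictScalars S.subtype).obj ((coextendScalars S.subtype).obj N)) where
  i := Φ.unitApp N
  r := (restrictCoextendScalarsAdj S.subtype).counit.app N ≫ ofHom
    { toFun := fun n => c • n
      map_add' := fun n n' => smul_add c n n'
      map_smul' := fun s n => by simp only [← mul_smul, hc, RingHom.id_apply] }
  retract := by
    ext n
    change c • Φ.toHom 1 • n = n
    rw [← mul_smul, h, one_smul]

theorem leftGlobalDimension_eq (Φ : FrobeniusSystem S ι) (hΦ : ∑ j, Φ.x j * Φ.y j = 1) (c : S)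
    (hc : ∀ s : S, s * c = c * s) (h : c * Φ.toHom 1 = 1) :
    leftGlobalDimension S = leftGlobalDimension A :=
  iSup_projectiveDimension_eq_of_biadjoint (restrictCoextendScalarsAdj.{u, u, u} S.subtype)
    Φ.coextendRestrictAdj (fun M => ⟨Φ.retractCoextend hΦ M⟩)
    (fun N => ⟨Φ.retractRestrict c hc h N⟩)

/-- The Frobenius isomorphism `A ≅ Hom_S(A, S)` of left `A`-modules, as a retraction. -/
noncomputable def retractCoextendSelf :
    Retract (ModuleCat.of A A) ((coextendScalars S.subtype).obj (ModuleCat.of S S)) where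
  i := ofHom
    { toFun := fun a => (coextendEquiv (ModuleCat.of S S)).symm (Φ.toDual a)
      map_add' := fun a b => (coextendEquiv (ModuleCat.of S S)).injective
        (LinearMap.ext fun y : A => by
          change Φ.toHom (y * (a + b)) = Φ.toHom (y * a) + Φ.toHom (y * b)
          rw [mul_add, map_add])
      map_smul' := fun a b => (coextendEquiv (ModuleCat.of S S)).injective
        (LinearMap.ext fun y : A => by
          change Φ.toHom (y * (a * b)) = Φ.toHom (y * a * b)
          rw [mul_assoc]) }
  r := ofHom
    { toFun := fun f => ∑ j, Φ.x j * (coextendEquiv (ModuleCat.of S S) f (Φ.y j) : S)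
      map_add' := fun f g => by
        rw [← Finset.sum_add_distrib]
        exact Finset.sum_congr rfl fun j _ => mul_add (Φ.x j) _ _
      map_smul' := fun a f => Φ.sum_smul_map_mul (M := A)
        { toFun := fun b => (coextendEquiv (ModuleCat.of S S) f b : S)
          map_add' := fun b b' => congrArg S.subtype
            (map_add (coextendEquiv (ModuleCat.of S S) f) b b')
          map_smul' := fun s b => congrArg S.subtype
            (map_smul (coextendEquiv (ModuleCat.of S S) f) s b) } a }
  retract := by
    ext
    exact Φ.sum_left 1

/-- The inclusion `S → A` is split as a map of left `S`-modules. -/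
noncomputable def retractSelf (c : S) (hc : ∀ s : S, s * c = c * s) (h : c * Φ.toHom 1 = 1) :
    Retract (ModuleCat.of S S) ((restrictScalars S.subtype).obj (ModuleCat.of A A)) where
  i := ofHom (Y := (restrictScalars S.subtype).obj (ModuleCat.of A A))
    { toFun := fun s => (s : A)
      map_add' := fun s t => rfl
      map_smul' := fun s t => rfl }
  r := ofHom (X := (restrictScalars S.subtype).obj (ModuleCat.of A A))
    { toFun := fun a : A => c * Φ.toHom a
      map_add' := fun a b : A => (congrArg (c * ·) (map_add Φ.toHom a b)).trans (mul_add _ _ _)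
      map_smul' := fun s (a : A) => by
        change c * Φ.toHom (s * a) = s * (c * Φ.toHom a)
        rw [Φ.map_mul_left, ← mul_assoc, ← hc, mul_assoc] }
  retract := by
    ext
    exact congrArg Subtype.val h

theorem leftDominantDimension_eq (Φ : FrobeniusSystem S ι) (c : S)
    (hc : ∀ s : S, s * c = c * s) (h : c * Φ.toHom 1 = 1) :
    leftDominantDimension S = leftDominantDimension A := by
  have : (coextendScalars.{u, u, u} S.subtype).Additive :=
    (restrictCoextendScalarsAdj.{u, u, u} S.subtype).right_adjoint_additive
  exact leftDominantDimension_congr fun m =>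
    ⟨fun hS => hasDominantDimensionGE_of_retract Φ.retractCoextendSelf
      (hS.obj_of_biadjoint Φ.coextendRestrictAdj (restrictCoextendScalarsAdj S.subtype)),
    fun hA => hasDominantDimensionGE_of_retract (Φ.retractSelf c hc h)
      (hA.obj_of_biadjoint (restrictCoextendScalarsAdj S.subtype) Φ.coextendRestrictAdj)⟩

/-- Semisimplicity descends along split Frobenius extensions. -/
theorem isSemisimpleRing (Φ : FrobeniusSystem S ι) [IsSemisimpleRing A] (c : S)
    (hc : ∀ s : S, s * c = c * s) (h : c * Φ.toHom 1 = 1) : IsSemisimpleRing S := by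
  have hproj : ∀ N : ModuleCat.{u} S, Module.Projective S N := fun N => by
    have hP : Projective ((coextendScalars.{u, u, u} S.subtype).obj N) :=
      (IsProjective.iff_projective _).1 (Module.projective_of_isSemisimpleRing A _)
    -- Coextension, being also a left adjoint, preserves epimorphisms, so its left adjoint,
    -- restriction, preserves projectives.
    have := Functor.preservesEpimorphisms_of_adjunction Φ.coextendRestrictAdj
    have := (restrictCoextendScalarsAdj.{u, u, u} S.subtype).map_projective _ hP
    exact (IsProjective.iff_projective _).2 (Φ.retractRestrict c hc h N).projective
  refine (isSemisimpleModule_iff S S).2 ⟨fun I => ?_⟩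
  have : Module.Projective S (S ⧸ I) := hproj (ModuleCat.of S (S ⧸ I))
  obtain ⟨s, hs⟩ := I.mkQ.exists_rightInverse_of_surjective
    (LinearMap.range_eq_top.2 I.mkQ_surjective)
  let p : S →ₗ[S] I := (LinearMap.id - s ∘ₗ I.mkQ).codRestrict I fun x => by
    refine (Submodule.Quotient.mk_eq_zero I).1 ?_
    rw [← Submodule.mkQ_apply, LinearMap.sub_apply, map_sub, sub_eq_zero]
    exact (LinearMap.congr_fun hs (I.mkQ x)).symm
  refine ⟨_, LinearMap.isCompl_of_proj (f := p) fun x => Subtype.ext ?_⟩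
  have : I.mkQ x = 0 := by simp
  simp [p, -Submodule.mkQ_apply, this]

end FrobeniusSystem

end FrobeniusSystem

/-! ### Morita invariance for matrix rings. -/

section MatrixRing

variable {R : Type u} [Ring R]

theorem HasDominantDimensionGE.pi {ι : Type} [Fintype ι] {m : ℕ} {X : ModuleCat.{u} R}
    (h : HasDominantDimensionGE m X) : HasDominantDimensionGE m (ModuleCat.of R (ι → X)) := by
  induction h with
  | zero X => exact .zero _
  | succ S hS hI hP _ ih =>
    have hex := (ShortComplex.ShortExact.moduleCat_exact_iff_function_exact _).1 hS.exact
    have hinj := (ModuleCat.mono_iff_injective _).1 hS.mono_f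
    have hsurj := (ModuleCat.epi_iff_surjective _).1 hS.epi_g
    let T : ShortComplex (ModuleCat.{u} R) :=
      ShortComplex.mk (X₁ := ModuleCat.of R (ι → S.X₁)) (X₂ := ModuleCat.of R (ι → S.X₂))
        (X₃ := ModuleCat.of R (ι → S.X₃)) (ModuleCat.ofHom (S.f.hom.compLeft ι))
        (ModuleCat.ofHom (S.g.hom.compLeft ι)) (by
          ext x
          exact hex.apply_apply_eq_zero _)
    have hT : T.ShortExact :=
      { exact := (ShortComplex.ShortExact.moduleCat_exact_iff_function_exact _).2 fun x => by
          refine funext_iff.trans ((forall_congr' fun k => hex (x k)).trans ?_)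
          refine Classical.skolem.trans (exists_congr fun y => ?_)
          exact funext_iff.symm
        mono_f := (ModuleCat.mono_iff_injective _).2 hinj.comp_left
        epi_g := (ModuleCat.epi_iff_surjective _).2 hsurj.comp_left }
    have hI' : Module.Injective R S.X₂ := (Module.injective_iff_injective_object R _).2 hI
    have hP' : Module.Projective R S.X₂ := (IsProjective.iff_projective _).2 hP
    have hI'' : Module.Injective R (ι → S.X₂) := inferInstance
    have hP'' : Module.Projective R (ι → S.X₂) := by
      classical exact .of_equiv (DFinsupp.linearEquivFunOnFintype (R := R) (M := fun _ : ι => S.X₂))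
    exact .succ T hT ((Module.injective_iff_injective_object R _).1 hI'')
      ((IsProjective.iff_projective _).1 hP'') ih

variable {n : ℕ}

instance toMatrixModCat_additive : (ModuleCat.toMatrixModCat.{u} R (Fin n)).Additive where
  map_add := rfl

theorem leftGlobalDimension_matrix (i : Fin n) :
    leftGlobalDimension (Matrix (Fin n) (Fin n) R) = leftGlobalDimension R := by
  let e := ModuleCat.matrixEquivalence.{u} R i
  have : e.functor.Additive := toMatrixModCat_additive
  exact iSup_projectiveDimension_eq_of_biadjoint e.toAdjunction e.symm.toAdjunction
    (fun X => ⟨(e.unitIso.app X).retract⟩) (fun X => ⟨(e.counitIso.symm.app X).retract⟩)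

/-- The ring of matrices is a retract of the module of columns with entries in `Rⁿ`. -/
def retractMatrix : Retract (ModuleCat.of (Matrix (Fin n) (Fin n) R) (Matrix (Fin n) (Fin n) R))
    ((ModuleCat.toMatrixModCat R (Fin n)).obj (ModuleCat.of R (Fin n → R))) where
  i := ModuleCat.ofHom
    (Y := (ModuleCat.toMatrixModCat R (Fin n)).obj (ModuleCat.of R (Fin n → R)))
    { toFun := fun a p q => a p q
      map_add' := fun _ _ => rfl
      map_smul' := fun a b => by
        funext p q
        change (a * b) p q = (∑ k, a p k • b k) q
        simp [Matrix.mul_apply] }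
  r := ModuleCat.ofHom
    (X := (ModuleCat.toMatrixModCat R (Fin n)).obj (ModuleCat.of R (Fin n → R)))
    { toFun := fun v => Matrix.of fun p q => v p q
      map_add' := fun _ _ => rfl
      map_smul' := fun a v => by
        ext p q
        change (∑ k, a p k • v k) q = (a * Matrix.of fun p q => v p q) p q
        simp [Matrix.mul_apply] }
  retract := rfl

/-- The module of columns is a retract of the ring of matrices. -/
def retractColumn (i : Fin n) : Retract ((ModuleCat.toMatrixModCat R (Fin n)).obj (ModuleCat.of R R))
    (ModuleCat.of (Matrix (Fin n) (Fin n) R) (Matrix (Fin n) (Fin n) R)) where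
  i := ModuleCat.ofHom
    { toFun := fun v => Matrix.of fun p _ => v p
      map_add' := fun _ _ => rfl
      map_smul' := fun a v => by
        ext p q
        simp [Matrix.mul_apply, Matrix.Module.smul_apply] }
  r := ModuleCat.ofHom
    { toFun := fun a p => a p i
      map_add' := fun _ _ => rfl
      map_smul' := fun a b => by
        ext p
        simp [Matrix.mul_apply, Matrix.Module.smul_apply] }
  retract := rfl

theorem leftDominantDimension_matrix (i : Fin n) :
    leftDominantDimension (Matrix (Fin n) (Fin n) R) = leftDominantDimension R := by
  let e := ModuleCat.matrixEquivalence.{u} R i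
  have : e.functor.Additive := toMatrixModCat_additive
  have : e.symm.functor.Additive := e.inverse_additive
  -- The regular modules do not correspond under the equivalence: `R` goes to the column module, a
  -- summand of the matrix ring, and the matrix ring comes from `Fin n → R`, hence the use of `pi`.
  refine leftDominantDimension_congr fun m => ⟨fun h => ?_, fun h => ?_⟩
  · exact ModuleCat.hasDominantDimensionGE_of_retract (e.unitIso.app (ModuleCat.of R R)).retract
      ((ModuleCat.hasDominantDimensionGE_of_retract (retractColumn i) h).obj_of_biadjoint
        e.symm.toAdjunction e.toAdjunction)
  · exact ModuleCat.hasDominantDimensionGE_of_retract retractMatrix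
      (h.pi.obj_of_biadjoint e.toAdjunction e.symm.toAdjunction)

end MatrixRing

/-! ### The Frobenius system of a free point. -/

section GroupCentralizer

open Matrix

variable {R : Type u} [Ring R] {n : ℕ} (G : Subgroup (GL (Fin n) R))

theorem mem_groupCentralizerRing {a : Matrix (Fin n) (Fin n) R} :
    a ∈ groupCentralizerRing G ↔
      ∀ g ∈ G, (g : Matrix (Fin n) (Fin n) R) * a = a * (g : Matrix (Fin n) (Fin n) R) := by
  simp [groupCentralizerRing, centralizerMatrixRing, Subring.mem_centralizer_iff]

/-- The trace of the conjugation action of `G` on matrices. -/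
def conjugationTrace [Fintype G] : Matrix (Fin n) (Fin n) R →+ groupCentralizerRing G where
  toFun a := ⟨∑ g : G, ((g : GL (Fin n) R) : Matrix (Fin n) (Fin n) R) * a *
      (((g : GL (Fin n) R)⁻¹ : GL (Fin n) R) : Matrix (Fin n) (Fin n) R), by
    rw [mem_groupCentralizerRing]
    intro h hh
    rw [Finset.mul_sum, Finset.sum_mul]
    refine Fintype.sum_equiv (Equiv.mulLeft (⟨h, hh⟩ : G)) _ _ fun g => ?_
    simp only [Equiv.coe_mulLeft, Subgroup.coe_mul, _root_.mul_inv_rev, Units.val_mul, mul_assoc,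
      Units.inv_mul, mul_one]⟩
  map_zero' := by ext1; simp
  map_add' a b := by ext1; simp [mul_add, add_mul, Finset.sum_add_distrib]

theorem conjugationTrace_coe [Fintype G] (a : Matrix (Fin n) (Fin n) R) :
    (conjugationTrace G a : Matrix (Fin n) (Fin n) R) =
      ∑ g : G, ((g : GL (Fin n) R) : Matrix (Fin n) (Fin n) R) * a *
        (((g : GL (Fin n) R)⁻¹ : GL (Fin n) R) : Matrix (Fin n) (Fin n) R) := rfl

variable {G}

/-- Each summand is `g_{ii} e_{pp}`, so the sum is the scalar matrix `g_{ii}`; this is the only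
place where freeness enters. -/
theorem IsFreePoint.sum_single_mul {i : Fin n} (hi : IsFreePoint G i) (g : GL (Fin n) R)
    (hg : g ∈ G) [Decidable (g = 1)] :
    ∑ p, single p i (1 : R) * (g : Matrix (Fin n) (Fin n) R) * single i p 1 =
      if g = 1 then 1 else 0 := by
  have : ∀ p, single p i (1 : R) * (g : Matrix (Fin n) (Fin n) R) * single i p 1 =
      single p p ((g : Matrix (Fin n) (Fin n) R) i i) := fun p => by simp
  simp only [this]
  split_ifs with h
  · simp [h, sum_single_one]
  · simp [hi g hg h]

/-- The Frobenius system of `S_n(G, R) ⊆ M_n(R)` attached to a free point of `G`. -/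
def IsFreePoint.frobeniusSystem [Fintype G] {i : Fin n} (hi : IsFreePoint G i) :
    FrobeniusSystem (groupCentralizerRing G) (Fin n) where
  toHom := conjugationTrace G
  map_mul_left s a := by
    ext1
    rw [Subring.coe_mul, conjugationTrace_coe, conjugationTrace_coe, Finset.mul_sum]
    refine Finset.sum_congr rfl fun g _ => ?_
    rw [← mul_assoc, (mem_groupCentralizerRing G).1 s.2 g g.2]
    simp only [mul_assoc]
  map_mul_right a s := by
    ext1
    rw [Subring.coe_mul, conjugationTrace_coe, conjugationTrace_coe, Finset.sum_mul]
    refine Finset.sum_congr rfl fun g _ => ?_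
    simp only [mul_assoc]
    rw [(mem_groupCentralizerRing G).1 s.2 _ (G.inv_mem g.2)]
  x p := single p i 1
  y p := single i p 1
  sum_left a := by
    classical
    calc _ = ∑ g : G, (∑ p, single p i (1 : R) * ((g : GL (Fin n) R) : Matrix (Fin n) (Fin n) R) *
          single i p 1) * (a * (((g : GL (Fin n) R)⁻¹ : GL (Fin n) R) : Matrix _ _ R)) := by
            simp only [conjugationTrace_coe, Finset.mul_sum, Finset.sum_mul]
            rw [Finset.sum_comm]
            simp only [mul_assoc]
      _ = a := by
        simp only [hi.sum_single_mul _ (Subtype.coe_prop _), ite_mul, one_mul, zero_mul]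
        rw [Fintype.sum_eq_single (1 : G) fun g hg => if_neg (by simpa using hg)]
        simp
  sum_right a := by
    classical
    calc _ = ∑ g : G, ((g : GL (Fin n) R) : Matrix (Fin n) (Fin n) R) * a *
          ∑ p, single p i (1 : R) * (((g : GL (Fin n) R)⁻¹ : GL (Fin n) R) : Matrix _ _ R) *
            single i p 1 := by
            simp only [conjugationTrace_coe, Finset.mul_sum, Finset.sum_mul]
            rw [Finset.sum_comm]
            simp only [mul_assoc]
      _ = a := by
        simp only [hi.sum_single_mul _ (G.inv_mem (Subtype.coe_prop _)), mul_ite, mul_one, mul_zero]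
        rw [Fintype.sum_eq_single (1 : G) fun g hg => if_neg (by simpa using hg)]
        simp

theorem IsFreePoint.sum_x_mul_y [Fintype G] {i : Fin n} (hi : IsFreePoint G i) :
    ∑ p, hi.frobeniusSystem.x p * hi.frobeniusSystem.y p = 1 := by
  simp [frobeniusSystem, sum_single_one]

/-- The inverse of the order of `G` is a central element of `S_n(G, R)`. -/
theorem exists_central_inverse_card [Fintype G] (hG : IsUnit ((Nat.card G : ℕ) : R)) :
    ∃ c : groupCentralizerRing G, (∀ s, s * c = c * s) ∧ c * conjugationTrace G 1 = 1 := by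
  -- The inverse of an integer that is a unit is central in `R`, so its scalar matrix commutes with
  -- all of `M_n(R)`.
  obtain ⟨b, hb, hcomm⟩ : ∃ b : R, b * (Nat.card G : ℕ) = 1 ∧ ∀ r, Commute b r := by
    obtain ⟨v, hv⟩ := hG
    refine ⟨(v⁻¹ : Rˣ), by rw [← hv, Units.inv_mul], fun r => Commute.units_inv_left ?_⟩
    rw [hv]
    exact Nat.cast_commute _ r
  have hscalar : ∀ a : Matrix (Fin n) (Fin n) R, scalar (Fin n) b * a = a * scalar (Fin n) b :=
    fun a => scalar_commute b hcomm a
  refine ⟨⟨scalar (Fin n) b, ?_⟩, fun s => Subtype.ext (hscalar _).symm, ?_⟩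
  · rw [mem_groupCentralizerRing]
    exact fun g _ => (hscalar _).symm
  · ext1
    rw [Subring.coe_mul, conjugationTrace_coe]
    simp only [mul_one, Units.mul_inv, Finset.sum_const, Finset.card_univ]
    rw [← Nat.card_eq_fintype_card, nsmul_eq_mul, mul_one, ← map_natCast (scalar (Fin n)), ← map_mul,
      hb, map_one]
    rfl

end GroupCentralizer

theorem corollary3p7 {R : Type u} [Ring R] {n : ℕ} (G : Subgroup (GL (Fin n) R)) [Finite G]
    (hfree : ∃ i : Fin n, IsFreePoint G i) (hG : IsUnit ((Nat.card G : ℕ) : R)) :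
    (IsFrobeniusExtension (groupCentralizerRing G) ∧
      IsSplitExtension (groupCentralizerRing G) ∧
      leftGlobalDimension (groupCentralizerRing G) = leftGlobalDimension R ∧
      leftDominantDimension (groupCentralizerRing G) = leftDominantDimension R) ∧
    (IsSemisimpleRing R → IsSemisimpleRing (groupCentralizerRing G)) := by
  have := Fintype.ofFinite G
  obtain ⟨i, hi⟩ := hfree
  obtain ⟨c, hc, h⟩ := exists_central_inverse_card hG
  let Φ := hi.frobeniusSystem
  exact ⟨⟨Φ.isFrobeniusExtension, Φ.isSplitExtension c hc h,
    (Φ.leftGlobalDimension_eq hi.sum_x_mul_y c hc h).trans (leftGlobalDimension_matrix i),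
    (Φ.leftDominantDimension_eq c hc h).trans (leftDominantDimension_matrix i)⟩,
    fun _ => Φ.isSemisimpleRing c hc h⟩
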